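/- Let $X$ denote either the complex vector space of continuous functions $f:\mathbb{R}\to\mathbb{C}$ or the complex vector space of complex valued Schwartz distributions on $\mathbb{R}$. For $h\in\mathbb{R}$ let $\tau_h:X\to X$ be the translation operator, given by $\tau_h(f)(t)=f(t+h)$ if $f$ is a continuous function, and by $\tau_h(f)\{\phi\}=f\{\tau_{-h}(\phi)\}$ for all test functions $\phi$ (where $\tau_{-h}(\phi)(t)=\phi(t-h)$) if $f$ is a distribution. Put $\Delta_h=\tau_h-1$ (with $1$ the identity operator), $\Delta_h^1=\Delta_h$, $\Delta_h^{k+1}=\Delta_h\Delta_h^k$ for $k\ge 1$, and $\Delta_{h_1h_2\cdots h_m}=\Delta_{h_1}\Delta_{h_2}\cdots\Delta_{h_m}$ for $h_1,\dots,h_m\in\mathbb{R}$. Let $m\ge 1$ be an integer and let $V$ be a finite dimensional complex vector subspace of $X$. Then the following statements are equivalent: (i) $\Delta_h^m(V)\subseteq V$ for all $h\in\mathbb{R}$. (ii) $\Delta_{h_1h_2\cdots h_m}(V)\subseteq V$ for all $(h_1,h_2,\dots,h_m)\in\mathbb{R}^m$. -/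

import Mathlib

open TopologicalSpace
open scoped Distributions

namespace DeltaInvariant

/-- Translation of continuous functions: `(τ_h f)(t) = f(t + h)`. -/
noncomputable def translateFun (h : ℝ) : Module.End ℂ C(ℝ, ℂ) where
  toFun f := ⟨fun t => f (t + h), by fun_prop⟩
  map_add' _ _ := rfl
  map_smul' _ _ := rfl

/-- Test functions on the whole real line: smooth, compactly supported functions `ℝ → ℝ`,
with the canonical LF topology. -/
abbrev Test : Type := 𝓓((⊤ : Opens ℝ), ℝ)

/-- Complex valued Schwartz distributions on the real line: continuous real-linear maps
from the real valued test functions to `ℂ`. Complexification of the test functions identifies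
them with the continuous complex-linear functionals on the complex valued test functions. -/
abbrev Distr : Type := 𝓓'((⊤ : Opens ℝ), ℂ)

/-- Translation of a test function, `t ↦ φ(t + h)`, as a test function. -/
noncomputable def translateTestFun (h : ℝ) (φ : Test) : Test where
  toFun t := φ (t + h)
  contDiff' := φ.contDiff.comp (contDiff_id.add contDiff_const)
  hasCompactSupport' := φ.hasCompactSupport.comp_homeomorph (Homeomorph.addRight h)
  tsupport_subset' _ _ := trivial

/-- Translation of test functions, `(τ_h φ)(t) = φ(t + h)`, as a continuous linear map. -/
noncomputable def translateTest (h : ℝ) : Test →L[ℝ] Test :=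
  TestFunction.limitCLM ℝ (translateTestFun h)
    (fun K _ =>
      let K' : Compacts ℝ := K.map (fun t => t - h) (by fun_prop)
      TestFunction.ofSupportedInCLM ℝ (Set.subset_univ (K' : Set ℝ)) ∘L
        ContDiffMapSupportedIn.mkCLM ℝ (K₁ := K) (K₂ := K') (fun φ t => φ (t + h))
          (fun _ _ _ => rfl) (fun _ _ _ => rfl)
          (fun φ => φ.contDiff.comp (contDiff_id.add contDiff_const))
          (fun φ t ht => φ.zero_on_compl fun hK => ht ⟨t + h, hK, add_sub_cancel_right t h⟩)
          (fun i hi => ⟨{i}, 1, zero_le_one, fun φ t _ => by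
            rw [iteratedFDeriv_comp_add_right, one_mul, Finset.sup_singleton]
            exact ContDiffMapSupportedIn.norm_iteratedFDeriv_apply_le_seminorm ℝ hi⟩))
    (fun _ _ _ => rfl)

theorem translateTest_apply (h : ℝ) (φ : Test) (t : ℝ) : translateTest h φ t = φ (t + h) := rfl

/-- Translation of distributions: `(τ_h T){φ} = T{τ_{-h} φ}`. -/
noncomputable def translateDistr (h : ℝ) : Module.End ℂ Distr where
  toFun T := T.comp (translateTest (-h))
  map_add' _ _ := rfl
  map_smul' _ _ := rfl

theorem translateDistr_apply (h : ℝ) (T : Distr) (φ : Test) :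
    translateDistr h T φ = T (translateTest (-h) φ) := rfl

section Difference

variable {X : Type*} [AddCommGroup X] [Module ℂ X]

/-- The first difference operator `Δ_h = τ_h - 1` of a family `τ` of translation operators. -/
def diff (τ : ℝ → Module.End ℂ X) (h : ℝ) : Module.End ℂ X := τ h - 1

/-- The iterated difference operator `Δ_h^m`: `Δ_h^0 = 1` and `Δ_h^(m+1) = Δ_h ∘ Δ_h^m`. -/
def iterDiff (τ : ℝ → Module.End ℂ X) : ℕ → ℝ → Module.End ℂ X
  | 0, _ => 1
  | m + 1, h => diff τ h ∘ₗ iterDiff τ m h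

/-- The mixed difference operator `Δ_{h₁h₂⋯h_m}`:
`Δ_{h₁h₂⋯h_m} = Δ_{h₁} ∘ Δ_{h₂⋯h_m}`, and the identity for the empty list of steps. -/
def mixedDiff (τ : ℝ → Module.End ℂ X) : (m : ℕ) → (Fin m → ℝ) → Module.End ℂ X
  | 0, _ => 1
  | m + 1, h => diff τ (h 0) ∘ₗ mixedDiff τ m (fun i => h i.succ)

end Difference

end DeltaInvariant

/-! Equal steps give (ii) ⇒ (i). For the converse, enlarge V to a finite dimensional W stable under
all translations. The sum of the T^k V, k < m, is T-stable when T^m V ⊆ V; doing this for Δ_1 and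
then for Δ_√2 gives stability under a dense group of translations, hence under all of them by
continuity (`exists_translation_invariant`).

On W the translations form a continuous one-parameter group exp(tD), and the operators preserving V
form a closed linear space N. Differentiating (exp(tD) - 1)^m ∈ N at t = 0 gives D^k ∈ N for all k ≥
m, and integrating m times from D^m exp(sD) ∈ N gives the mixed products (`prod_sub_one_mem`). -/

namespace DeltaInvariant

/-! ### One-parameter semigroups in Banach algebras -/

section OneParameter

open Filter Topology

variable {A : Type*} [NormedRing A] [NormedAlgebra ℝ A] [CompleteSpace A]

/-- A continuous one-parameter semigroup in a Banach algebra is differentiable. -/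
theorem exists_hasDerivAt_of_continuous_hom {ρ : ℝ → A} (hc : Continuous ρ) (h0 : ρ 0 = 1)
    (hadd : ∀ s t, ρ (s + t) = ρ s * ρ t) : ∃ D : A, ∀ t, HasDerivAt ρ (ρ t * D) t := by
  set I : ℝ → A := fun t => ∫ s in (0 : ℝ)..t, ρ s with hI
  have hIderiv : ∀ t, HasDerivAt I (ρ t) t := fun t =>
    intervalIntegral.integral_hasDerivAt_right (hc.intervalIntegrable _ _)
      (hc.stronglyMeasurableAtFilter _ _) hc.continuousAt
  -- The averages of ρ over [0, a] tend to ρ 0 = 1, and units form an open set.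
  have hunit : ∀ᶠ a in 𝓝[≠] (0 : ℝ), IsUnit (a⁻¹ • I a) := by
    have h1 : Tendsto (fun a : ℝ => a⁻¹ • I a) (𝓝[≠] 0) (𝓝 1) := by
      have := hasDerivAt_iff_tendsto_slope_zero.1 (hIderiv 0)
      simpa [hI, h0] using this
    exact h1.eventually (Units.isOpen.mem_nhds isUnit_one)
  obtain ⟨a, hau, ha⟩ := (hunit.and self_mem_nhdsWithin).exists
  have ha0 : a ≠ 0 := ha
  have hMu : IsUnit (I a) := by
    have := hau.smul (Units.mk0 a ha0)
    rwa [Units.smul_mk0, smul_inv_smul₀ ha0] at this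
  obtain ⟨u, hu⟩ := hMu
  have hshift : ∀ t, ρ t = (I (t + a) - I t) * (↑u⁻¹ : A) := by
    intro t
    have h2 : ρ t * I a = I (t + a) - I t := by
      rw [hI]
      simp only
      rw [intervalIntegral.integral_interval_sub_left (hc.intervalIntegrable _ _)
        (hc.intervalIntegrable _ _)]
      have h3 := (ContinuousLinearMap.mul ℝ A (ρ t)).intervalIntegral_comp_comm
        (hc.intervalIntegrable (μ := MeasureTheory.volume) 0 a)
      simp only [ContinuousLinearMap.mul_apply', ← hadd] at h3
      rw [← h3, intervalIntegral.integral_comp_add_left, add_zero]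
    rw [← h2, ← hu, mul_assoc, Units.mul_inv, mul_one]
  have hdiff : ∀ t, DifferentiableAt ℝ ρ t := by
    intro t
    rw [funext hshift]
    have h3 : HasDerivAt (fun t => I (t + a)) (ρ (t + a)) t :=
      (hIderiv (t + a)).comp_add_const t a
    exact ((h3.sub (hIderiv t)).mul_const _).differentiableAt
  refine ⟨deriv ρ 0, fun t => ?_⟩
  have h4 : HasDerivAt (fun s => ρ t * ρ (s - t)) (ρ t * deriv ρ 0) t := by
    have h5 : HasDerivAt (fun s => ρ (s - t)) (deriv ρ 0) t := by
      refine HasDerivAt.comp_sub_const t t ?_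
      rw [sub_self]; exact (hdiff 0).hasDerivAt
    exact h5.const_mul _
  refine h4.congr_of_eventuallyEq (Eventually.of_forall fun s => ?_)
  simp only [← hadd, add_sub_cancel]

/-- A continuous one-parameter semigroup in a Banach algebra is an exponential. -/
theorem exists_eq_exp_of_continuous_hom {ρ : ℝ → A} (hc : Continuous ρ) (h0 : ρ 0 = 1)
    (hadd : ∀ s t, ρ (s + t) = ρ s * ρ t) : ∃ D : A, ∀ t, ρ t = NormedSpace.exp (t • D) := by
  obtain ⟨D, hD⟩ := exists_hasDerivAt_of_continuous_hom hc h0 hadd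
  refine ⟨D, fun t => ?_⟩
  -- This product is constant in s; its values at s = t and s = 0 are the two sides.
  have hder : ∀ s, HasDerivAt (fun s => ρ s * NormedSpace.exp ((t - s) • D)) 0 s := by
    intro s
    have h1 : HasDerivAt (fun s : ℝ => NormedSpace.exp ((t - s) • D))
        (-(D * NormedSpace.exp ((t - s) • D))) s := by
      have := (hasDerivAt_exp_smul_const' (𝕂 := ℝ) D (t - s)).scomp s
        ((hasDerivAt_id s).const_sub t)
      simpa [Function.comp_def] using this
    refine ((hD s).mul h1).congr_deriv ?_
    rw [mul_neg, mul_assoc, add_neg_cancel]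
  have := is_const_of_deriv_eq_zero (fun s => (hder s).differentiableAt)
    (fun s => (hder s).deriv) t 0
  simpa [h0] using this

theorem stirlingSecond_pos {m k : ℕ} (hm : 1 ≤ m) (hk : m ≤ k) : 0 < Nat.stirlingSecond k m := by
  induction k generalizing m with
  | zero => omega
  | succ k ih =>
    obtain ⟨m, rfl⟩ := Nat.exists_eq_add_of_le' hm
    rw [Nat.stirlingSecond_succ_succ]
    rcases Nat.eq_zero_or_pos m with rfl | hm'
    · rcases Nat.eq_zero_or_pos k with rfl | hk'
      · simp
      · have := ih le_rfl hk'
        positivity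
    · have := ih hm' (by omega)
      omega

theorem contDiff_exp_smul (D : A) {n : WithTop ℕ∞} :
    ContDiff ℝ n (fun t : ℝ => NormedSpace.exp (t • D)) := by
  have := NormedSpace.exp_analytic (𝕂 := ℝ) (𝔸 := A)
  have h : AnalyticOnNhd ℝ (NormedSpace.exp : A → A) Set.univ := fun x _ => this x
  exact h.contDiff.comp (contDiff_id.smul contDiff_const)

theorem deriv_exp_sub_one_pow (D : A) (m : ℕ) :
    deriv (fun t : ℝ => (NormedSpace.exp (t • D) - 1) ^ (m + 1)) = fun t : ℝ =>
      ((m + 1 : ℕ) : ℝ) • (D * ((NormedSpace.exp (t • D) - 1) ^ (m + 1)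
        + (NormedSpace.exp (t • D) - 1) ^ m)) := by
  funext t
  refine HasDerivAt.deriv ?_
  have hcomm : ∀ t : ℝ, Commute D (NormedSpace.exp (t • D)) := fun t =>
    ((Commute.refl D).smul_right t).exp_right
  induction m with
  | zero =>
    simpa using (hasDerivAt_exp_smul_const' (𝕂 := ℝ) D t).sub_const 1
  | succ m ih =>
    have h1 := (hasDerivAt_exp_smul_const' (𝕂 := ℝ) D t).sub_const 1
    refine HasDerivAt.congr_of_eventuallyEq ((ih.mul h1).congr_deriv ?_)
      (Eventually.of_forall fun s => pow_succ _ _)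
    set Y := NormedSpace.exp (t • D) - 1 with hY
    have hX : NormedSpace.exp (t • D) = Y + 1 := (sub_add_cancel _ _).symm
    have hYD : Y ^ (m + 1) * D = D * Y ^ (m + 1) :=
      (((hcomm t).sub_right (Commute.one_right D)).pow_right (m + 1)).eq.symm
    rw [hX, ← mul_assoc (Y ^ (m + 1)), hYD, smul_mul_assoc, mul_assoc, mul_assoc D, add_mul,
      ← pow_succ, ← pow_succ, mul_add (Y ^ (m + 1)), ← pow_succ, mul_one,
      Nat.cast_succ (m + 1), add_smul, one_smul]

/-- By `deriv_exp_sub_one_pow`, the Taylor coefficients at 0 satisfy the recursion S(k+1, m+1) =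
(m+1) S(k, m+1) + S(k, m), up to the factor m!. -/
theorem iteratedDeriv_exp_sub_one_pow (D : A) (k m : ℕ) :
    iteratedDeriv k (fun t : ℝ => (NormedSpace.exp (t • D) - 1) ^ m) 0
      = ((m.factorial * Nat.stirlingSecond k m : ℕ) : ℝ) • D ^ k := by
  have hcd : ∀ m, ContDiff ℝ ⊤ (fun t : ℝ => (NormedSpace.exp (t • D) - 1) ^ m) := fun m =>
    ((contDiff_exp_smul D).sub contDiff_const).pow m
  induction k generalizing m with
  | zero => cases m <;> simp
  | succ k ih =>
    cases m with
    | zero => simp [iteratedDeriv_succ']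
    | succ m =>
      rw [iteratedDeriv_succ', deriv_exp_sub_one_pow]
      have e : iteratedDeriv k (fun t : ℝ =>
          ((m + 1 : ℕ) : ℝ) • (D * ((NormedSpace.exp (t • D) - 1) ^ (m + 1)
        + (NormedSpace.exp (t • D) - 1) ^ m))) 0 = ((m + 1 : ℕ) : ℝ) • (D *
          (iteratedDeriv k (fun t : ℝ => (NormedSpace.exp (t • D) - 1) ^ (m+1)) 0 +
          iteratedDeriv k (fun t : ℝ => (NormedSpace.exp (t • D) - 1) ^ m) 0)) := by
        have hk : ∀ m, ContDiffAt ℝ k (fun t : ℝ => (NormedSpace.exp (t • D) - 1) ^ m) 0 :=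
          fun m => ((hcd m).of_le le_top).contDiffAt
        have h1 := ((hk (m + 1)).add (hk m))
        rw [iteratedDeriv_fun_const_smul_field, iteratedDeriv_const_mul D h1]
        congr 2
        exact iteratedDeriv_add (hk (m + 1)) (hk m)
      rw [e, ih, ih, ← add_smul, mul_smul_comm, smul_smul, ← pow_succ',
        Nat.stirlingSecond_succ_succ, Nat.factorial_succ]
      congr 1
      push_cast
      ring

/-- A derivative lies in the closed span of the values of the function. -/
theorem iteratedDeriv_mem {F : Type*} [NormedAddCommGroup F] [NormedSpace ℝ F]
    {N : Submodule ℝ F} (hN : IsClosed (N : Set F)) (k : ℕ) {f : ℝ → F} (hf : ∀ t, f t ∈ N)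
    (t : ℝ) : iteratedDeriv k f t ∈ N := by
  induction k generalizing f t with
  | zero => simpa using hf t
  | succ k ih =>
    rw [iteratedDeriv_succ']
    refine ih (fun s => ?_) t
    have h1 := range_deriv_subset_closure_span_image (𝕜 := ℝ) f dense_univ ⟨s, rfl⟩
    have h2 : Submodule.span ℝ (f '' Set.univ) ≤ N := by
      rw [Submodule.span_le]
      rintro _ ⟨x, -, rfl⟩
      exact hf x
    exact closure_minimal h2 hN h1

/-- Modulo N the function has zero derivative, so it is constant. -/
theorem mem_of_hasDerivAt_mem {F : Type*} [NormedAddCommGroup F] [NormedSpace ℝ F]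
    {N : Submodule ℝ F} (hN : IsClosed (N : Set F)) {f f' : ℝ → F}
    (hf : ∀ t, HasDerivAt f (f' t) t) (hf' : ∀ t, f' t ∈ N) (h0 : f 0 ∈ N) (t : ℝ) : f t ∈ N := by
  have := hN
  have hd : ∀ t, HasDerivAt (fun t => N.mkQL (f t)) 0 t := fun t => by
    have := N.mkQL.hasFDerivAt.comp_hasDerivAt t (hf t)
    rwa [show N.mkQL (f' t) = 0 from (Submodule.Quotient.mk_eq_zero N).2 (hf' t)] at this
  have := is_const_of_deriv_eq_zero (fun s => (hd s).differentiableAt) (fun s => (hd s).deriv) t 0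
  rw [show N.mkQL (f 0) = 0 from (Submodule.Quotient.mk_eq_zero N).2 h0] at this
  exact (Submodule.Quotient.mk_eq_zero N).1 this

/-- A closed subspace containing all `(ρ h - 1) ^ m` contains all products of `m` factors
`ρ h - 1`. -/
theorem prod_sub_one_mem {ρ : ℝ → A} (hc : Continuous ρ) (h0 : ρ 0 = 1)
    (hadd : ∀ s t, ρ (s + t) = ρ s * ρ t) {N : Submodule ℝ A} (hN : IsClosed (N : Set A))
    {m : ℕ} (hm : 1 ≤ m) (hpow : ∀ h, (ρ h - 1) ^ m ∈ N) (h : Fin m → ℝ) :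
    (List.ofFn fun i => ρ (h i) - 1).prod ∈ N := by
  obtain ⟨D, hD⟩ := exists_eq_exp_of_continuous_hom hc h0 hadd
  have hDk : ∀ k, m ≤ k → D ^ k ∈ N := by
    intro k hk
    have h1 := iteratedDeriv_mem hN k hpow 0
    simp only [hD] at h1
    rw [iteratedDeriv_exp_sub_one_pow] at h1
    refine (N.smul_mem_iff ?_).1 h1
    exact_mod_cast (Nat.mul_pos m.factorial_pos (stirlingSecond_pos hm hk)).ne'
  have hDρ : ∀ s, D ^ m * ρ s ∈ N := by
    intro s
    rw [hD]
    have hs := (NormedSpace.exp_series_hasSum_exp' (𝕂 := ℝ) (s • D)).mul_left (D ^ m)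
    refine hN.mem_of_tendsto hs (Eventually.of_forall fun S => N.sum_mem fun k _ => ?_)
    rw [smul_pow, mul_smul_comm, mul_smul_comm, ← pow_add]
    exact N.smul_mem _ (N.smul_mem _ (hDk _ (Nat.le_add_right _ _)))
  have hρder : ∀ t, HasDerivAt ρ (D * ρ t) t := by
    intro t
    rw [funext hD]
    exact hasDerivAt_exp_smul_const' (𝕂 := ℝ) D t
  have hcomm : ∀ t : ℝ, Commute D (ρ t) := fun t => by
    rw [hD]
    exact ((Commute.refl D).smul_right t).exp_right
  -- Each integration trades a factor D for a factor ρ(h) - 1. The free parameter s is needed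
  -- because the derivative in the new step t involves ρ(s + t).
  have key : ∀ j ≤ m, ∀ (h : Fin j → ℝ) (s : ℝ),
      D ^ (m - j) * ρ s * (List.ofFn fun i => ρ (h i) - 1).prod ∈ N := by
    intro j
    induction j with
    | zero => intro _ h s; simpa using hDρ s
    | succ j ih =>
      intro hj h s
      set T := (List.ofFn fun i : Fin j => ρ (h i.succ) - 1).prod with hT
      have hF : ∀ t, HasDerivAt (fun t => D ^ (m - (j + 1)) * ρ s * ((ρ t - 1) * T))
          (D ^ (m - j) * ρ (s + t) * T) t := by
        intro t
        have h1 := (((hρder t).sub_const 1).mul_const T).const_mul (D ^ (m - (j + 1)) * ρ s)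
        convert h1 using 1
        rw [hadd, show m - j = (m - (j + 1)) + 1 by omega, pow_succ]
        simp only [mul_assoc]
        rw [← mul_assoc (ρ s) D, ← (hcomm s).eq, mul_assoc]
      rw [List.ofFn_succ, List.prod_cons]
      refine mem_of_hasDerivAt_mem hN hF (fun t => ih (by omega) _ _) ?_ (h 0)
      simp [h0]
  simpa [h0] using key m le_rfl h 0

theorem prod_sub_one_mem_of_complex {B : Type*} [NormedRing B] [NormedAlgebra ℂ B]
    [CompleteSpace B] {ρ : ℝ → B} (hc : Continuous ρ) (h0 : ρ 0 = 1)
    (hadd : ∀ s t, ρ (s + t) = ρ s * ρ t) {N : Submodule ℂ B} (hN : IsClosed (N : Set B))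
    {m : ℕ} (hm : 1 ≤ m) (hpow : ∀ h, (ρ h - 1) ^ m ∈ N) (h : Fin m → ℝ) :
    (List.ofFn fun i => ρ (h i) - 1).prod ∈ N :=
  letI : NormedAlgebra ℝ B := NormedAlgebra.restrictScalars ℝ ℂ B
  prod_sub_one_mem (N := N.restrictScalars ℝ) hc h0 hadd hN hm hpow h

end OneParameter

/-! ### Translation groups on functions and distributions -/

theorem translateFun_zero : translateFun 0 = 1 := by
  ext f t; simp [translateFun]

theorem translateFun_add (s t : ℝ) : translateFun (s + t) = translateFun s * translateFun t := by
  ext f x; simp [translateFun, add_assoc]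

theorem translateDistr_zero : translateDistr 0 = 1 := by
  ext T φ
  rw [translateDistr_apply, neg_zero]
  congr 1
  ext x
  simp [translateTest_apply]

theorem translateDistr_add (s t : ℝ) :
    translateDistr (s + t) = translateDistr s * translateDistr t := by
  ext T φ
  rw [Module.End.mul_apply, translateDistr_apply, translateDistr_apply, translateDistr_apply]
  congr 1
  ext x
  rw [translateTest_apply, translateTest_apply, translateTest_apply]
  congr 1
  ring

/-- Translation acts continuously on test functions. -/
theorem continuous_translateTest (φ : Test) : Continuous fun h : ℝ => translateTest h φ := by
  rw [continuous_iff_continuousAt]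
  intro h₀
  -- K contains the supports of all translates with |h - h₀| ≤ 1, so continuity reduces to uniform
  -- continuity of each derivative of φ.
  let K : Compacts ℝ := ⟨(fun p : ℝ × ℝ => p.1 - p.2) '' (tsupport φ ×ˢ Metric.closedBall h₀ 1),
    (φ.hasCompactSupport.isCompact.prod (isCompact_closedBall h₀ 1)).image (by fun_prop)⟩
  have hK : ∀ h ∈ Metric.closedBall h₀ 1, ∀ t, t ∉ (K : Set ℝ) → φ (t + h) = 0 := by
    intro h hh t ht
    by_contra hne
    exact ht ⟨(t + h, h), ⟨subset_tsupport _ hne, hh⟩, add_sub_cancel_right t h⟩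
  let ψ : Metric.closedBall h₀ 1 → 𝓓_{K}(ℝ, ℝ) := fun h =>
    { toFun := fun t => φ (t + h)
      contDiff' := φ.contDiff.comp (contDiff_id.add contDiff_const)
      zero_on_compl' := fun t ht => hK h h.2 t ht }
  have hψ : Continuous ψ := by
    rw [ContDiffMapSupportedIn.continuous_iff_comp]
    intro i
    rw [Metric.continuous_iff]
    intro h ε hε
    have hcs : HasCompactSupport (iteratedFDeriv ℝ i φ) := φ.hasCompactSupport.iteratedFDeriv i
    have hcont : Continuous (iteratedFDeriv ℝ i φ) :=
      φ.contDiff.continuous_iteratedFDeriv (by exact_mod_cast le_top)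
    obtain ⟨δ, hδ, H⟩ := Metric.uniformContinuous_iff.1
      (hcs.uniformContinuous_of_continuous hcont) (ε / 2) (half_pos hε)
    refine ⟨δ, hδ, fun h' hh' => ?_⟩
    refine lt_of_le_of_lt ((BoundedContinuousFunction.dist_le (half_pos hε).le).2 fun t => ?_)
      (half_lt_self hε)
    simp only [Function.comp_apply, ContDiffMapSupportedIn.structureMapCLM_top_apply]
    have e : ∀ h : Metric.closedBall h₀ 1,
        iteratedFDeriv ℝ i (ψ h) t = iteratedFDeriv ℝ i φ (t + h) := fun h =>
      iteratedFDeriv_comp_add_right i (h : ℝ) t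
    rw [e, e]
    refine (H ?_).le
    rwa [dist_add_left]
  have h1 : Continuous fun h : Metric.closedBall h₀ 1 => translateTest h φ :=
    (TestFunction.continuous_ofSupportedIn (Set.subset_univ (K : Set ℝ))).comp hψ
  exact (continuousOn_iff_continuous_domRestrict.2 h1).continuousAt
    (Metric.closedBall_mem_nhds h₀ one_pos)


/-! ### Reduction to a finite dimensional translation-invariant space -/

section Abstract

variable {X : Type*} [AddCommGroup X] [Module ℂ X]

theorem iterDiff_eq_pow (τ : ℝ → Module.End ℂ X) (m : ℕ) (h : ℝ) :
    iterDiff τ m h = (τ h - 1) ^ m := by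
  induction m with
  | zero => rfl
  | succ m ih => rw [pow_succ', ← ih]; rfl

theorem mixedDiff_eq_prod (τ : ℝ → Module.End ℂ X) (m : ℕ) (h : Fin m → ℝ) :
    mixedDiff τ m h = (List.ofFn fun i => τ (h i) - 1).prod := by
  induction m with
  | zero => rfl
  | succ m ih => rw [List.ofFn_succ, List.prod_cons, ← ih]; rfl

/-- A finite dimensional subspace invariant under `T ^ m` lies in a finite dimensional subspace
invariant under `T` and under everything commuting with `T` that preserves the original one. -/
theorem exists_invariant_of_pow {V : Submodule ℂ X} [FiniteDimensional ℂ V]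
    {T : Module.End ℂ X} {m : ℕ} (hm : 1 ≤ m) (hV : V.map (T ^ m) ≤ V) :
    ∃ W : Submodule ℂ X, V ≤ W ∧ FiniteDimensional ℂ W ∧ W.map T ≤ W ∧
      ∀ S : Module.End ℂ X, Commute S T → V.map S ≤ V → W.map S ≤ W := by
  have hle : ∀ k < m, V.map (T ^ k) ≤ ⨆ k : Fin m, V.map (T ^ (k : ℕ)) := fun k hk =>
    le_iSup (fun k : Fin m => V.map (T ^ (k : ℕ))) ⟨k, hk⟩
  have hVle : V ≤ ⨆ k : Fin m, V.map (T ^ (k : ℕ)) := by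
    have := hle 0 hm
    rwa [pow_zero, Module.End.one_eq_id, Submodule.map_id] at this
  refine ⟨⨆ k : Fin m, V.map (T ^ (k : ℕ)), hVle, inferInstance, ?_, fun S hST hS => ?_⟩
  · rw [Submodule.map_iSup]
    refine iSup_le fun k => ?_
    rw [← Submodule.map_comp, ← Module.End.mul_eq_comp, ← pow_succ']
    rcases Nat.lt_or_ge ((k : ℕ) + 1) m with h | h
    · exact hle _ h
    · rw [show (k : ℕ) + 1 = m by omega]
      exact hV.trans hVle
  · rw [Submodule.map_iSup]
    refine iSup_mono fun k => ?_
    rw [← Submodule.map_comp, ← Module.End.mul_eq_comp, (hST.pow_right k).eq,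
      Module.End.mul_eq_comp, Submodule.map_comp]
    exact Submodule.map_mono hS

variable {ι : Type*} {τ : ℝ → Module.End ℂ X} {E : X →ₗ[ℂ] ι → ℂ}

/-- A finite dimensional subspace preserved by a dense group of translations is preserved by
all translations. -/
theorem map_le_of_dense (h0 : τ 0 = 1) (hadd : ∀ s t, τ (s + t) = τ s * τ t)
    (hE : Function.Injective E) (hτ : ∀ x, Continuous fun h => E (τ h x))
    {W : Submodule ℂ X} [FiniteDimensional ℂ W] {s : Set ℝ}
    (hs : Dense (AddSubgroup.closure s : Set ℝ)) (hW : ∀ h ∈ s, W.map (τ h) ≤ W) (h : ℝ) :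
    W.map (τ h) ≤ W := by
  have hinv : ∀ h, τ (-h) * τ h = 1 := fun h => by rw [← hadd, neg_add_cancel, h0]
  have hinj : ∀ h, Function.Injective (τ h) := fun h =>
    Function.LeftInverse.injective (g := τ (-h)) fun x => by
      rw [← Module.End.mul_apply, hinv, Module.End.one_apply]
  let G : AddSubgroup ℝ :=
    { carrier := {h | W.map (τ h) = W}
      zero_mem' := by
        change W.map (τ 0) = W
        rw [h0, Module.End.one_eq_id, Submodule.map_id]
      add_mem' := fun {a b} (ha : W.map (τ a) = W) (hb : W.map (τ b) = W) => by
        change W.map (τ (a + b)) = W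
        rw [hadd, Module.End.mul_eq_comp, Submodule.map_comp, hb, ha]
      neg_mem' := fun {a} (ha : W.map (τ a) = W) => by
        change W.map (τ (-a)) = W
        conv_lhs => rw [← ha, ← Submodule.map_comp, ← Module.End.mul_eq_comp, hinv,
          Module.End.one_eq_id, Submodule.map_id] }
  -- Translations are injective, so on finite dimensional W the inclusion is an equality; this makes
  -- the stabilizer a group.
  have hsG : AddSubgroup.closure s ≤ G := (AddSubgroup.closure_le G).2 fun h hh =>
    Submodule.eq_of_le_of_finrank_eq (hW h hh)
      (Submodule.equivMapOfInjective (τ h) (hinj h) W).finrank_eq.symm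
  rintro _ ⟨w, hw, rfl⟩
  -- E supplies the topology of pointwise values, in which the finite dimensional image of W is
  -- closed.
  have hclosed : IsClosed {h | E (τ h w) ∈ W.map E} :=
    (Submodule.closed_of_finiteDimensional (W.map E)).preimage (hτ w)
  have hmem : ∀ x, E x ∈ W.map E → x ∈ W := fun x ⟨y, hy, hxy⟩ => hE hxy ▸ hy
  refine hmem _ (hclosed.closure_subset_iff.2 (fun g hg => ?_) (hs h))
  have hg' : W.map (τ g) = W := hsG hg
  exact Submodule.mem_map_of_mem (hg' ▸ Submodule.mem_map_of_mem hw)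

theorem exists_translation_invariant (h0 : τ 0 = 1) (hadd : ∀ s t, τ (s + t) = τ s * τ t)
    (hE : Function.Injective E) (hτ : ∀ x, Continuous fun h => E (τ h x))
    {V : Submodule ℂ X} [FiniteDimensional ℂ V] {m : ℕ} (hm : 1 ≤ m)
    (hV : ∀ h, V.map ((τ h - 1) ^ m) ≤ V) :
    ∃ W : Submodule ℂ X, V ≤ W ∧ FiniteDimensional ℂ W ∧ ∀ h, W.map (τ h) ≤ W := by
  have hcomm : ∀ s t, Commute (τ s - 1) (τ t - 1) := fun s t =>
    Commute.sub_left (Commute.sub_right (by rw [Commute, SemiconjBy, ← hadd, add_comm, hadd])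
      (Commute.one_right _)) (Commute.one_left _)
  -- Differences commute, so W₁ remains stable under Δ_√2^m, and W remains stable under Δ_1.
  obtain ⟨W₁, hVW₁, _, hW₁, hS₁⟩ := exists_invariant_of_pow hm (hV 1)
  obtain ⟨W, hW₁W, _, hW, hS⟩ := exists_invariant_of_pow (V := W₁) (T := τ √2 - 1) hm
    (hS₁ _ ((hcomm _ _).pow_left m) (hV _))
  refine ⟨W, hVW₁.trans hW₁W, ‹_›, map_le_of_dense h0 hadd hE hτ (s := {√2, 1})
    (dense_addSubgroupClosure_pair_iff.2 (by simpa using irrational_sqrt_two)) ?_⟩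
  have key : ∀ h, W.map (τ h - 1) ≤ W → W.map (τ h) ≤ W := by
    rintro h hh _ ⟨w, hw, rfl⟩
    have := W.add_mem (hh ⟨w, hw, rfl⟩) hw
    simpa using this
  rintro h (rfl | rfl)
  · exact key _ hW
  · exact key _ (hS _ (hcomm _ _) hW₁)

theorem map_mixedDiff_le (h0 : τ 0 = 1) (hadd : ∀ s t, τ (s + t) = τ s * τ t)
    (hE : Function.Injective E) (hτ : ∀ x, Continuous fun h => E (τ h x))
    {V : Submodule ℂ X} [FiniteDimensional ℂ V] {m : ℕ} (hm : 1 ≤ m)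
    (hV : ∀ h, V.map (iterDiff τ m h) ≤ V) (h : Fin m → ℝ) : V.map (mixedDiff τ m h) ≤ V := by
  simp only [iterDiff_eq_pow] at hV
  rw [mixedDiff_eq_prod]
  obtain ⟨W, hVW, _, hW⟩ := exists_translation_invariant h0 hadd hE hτ hm hV
  let F := Fin (Module.finrank ℂ W) → ℂ
  let e : F ≃ₗ[ℂ] W := (Module.finBasis ℂ W).equivFun.symm
  let f : F →ₗ[ℂ] X := W.subtype ∘ₗ e.toLinearMap
  have hf : Function.Injective f := Subtype.val_injective.comp e.injective
  let ρ : ℝ → F →L[ℂ] F := fun h => LinearMap.toContinuousLinearMap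
    (e.symm.conj ((τ h).restrict fun w hw => hW h ⟨w, hw, rfl⟩))
  have hρ : ∀ h y, f (ρ h y) = τ h (f y) := fun h y => by simp [f, ρ, LinearEquiv.conj_apply]
  have hρ' : ∀ h y, f ((ρ h - 1) y) = (τ h - 1) (f y) := fun h y => by simp [hρ]
  -- E ∘ f is a closed embedding of F, so continuity of orbits can be tested after E.
  have hcont : Continuous ρ := by
    rw [continuous_clm_apply]
    intro y
    have hemb := LinearMap.isClosedEmbedding_of_injective (𝕜 := ℂ) (f := E ∘ₗ f)
      (LinearMap.ker_eq_bot.2 (hE.comp hf))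
    rw [hemb.isEmbedding.continuous_iff]
    simpa only [Function.comp_def, LinearMap.comp_apply, hρ] using hτ (f y)
  let N : Submodule ℂ (F →L[ℂ] F) :=
    { carrier := {T | ∀ y ∈ V.comap f, T y ∈ V.comap f}
      zero_mem' := fun y _ => (V.comap f).zero_mem
      add_mem' := fun hS hT y hy => (V.comap f).add_mem (hS y hy) (hT y hy)
      smul_mem' := fun c _ hT y hy => (V.comap f).smul_mem c (hT y hy) }
  have hN : IsClosed (N : Set (F →L[ℂ] F)) := by
    have : (N : Set (F →L[ℂ] F)) = ⋂ y ∈ V.comap f, {T | T y ∈ V.comap f} := by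
      ext T; simp [N]
    rw [this]
    exact isClosed_biInter fun y _ => (Submodule.closed_of_finiteDimensional (V.comap f)).preimage
      (ContinuousLinearMap.apply ℂ F y).continuous
  have hpow : ∀ h (k : ℕ) y, f (((ρ h - 1) ^ k) y) = ((τ h - 1) ^ k) (f y) := by
    intro h k
    induction k with
    | zero => intro y; rfl
    | succ k ih =>
      intro y
      rw [pow_succ', pow_succ', mul_apply_eq_comp, hρ', ih, Module.End.mul_apply]
  have hprod : ∀ (k : ℕ) (h : Fin k → ℝ) y, f ((List.ofFn fun i => ρ (h i) - 1).prod y)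
      = (List.ofFn fun i => τ (h i) - 1).prod (f y) := by
    intro k
    induction k with
    | zero => intro h y; rfl
    | succ k ih =>
      intro h y
      rw [List.ofFn_succ, List.ofFn_succ, List.prod_cons, List.prod_cons,
        mul_apply_eq_comp, hρ', ih, Module.End.mul_apply]
  have hmem := prod_sub_one_mem_of_complex hcont
    (ContinuousLinearMap.ext fun y => hf <| by rw [hρ, h0]; rfl)
    (fun s t => ContinuousLinearMap.ext fun y => hf <| by
      rw [mul_apply_eq_comp, hρ, hρ, hρ, hadd, Module.End.mul_apply])
    hN hm (fun h y hy => by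
      rw [Submodule.mem_comap, hpow]
      exact hV h ⟨f y, hy, rfl⟩) h
  rintro _ ⟨v, hv, rfl⟩
  have hfv : f (e.symm ⟨v, hVW hv⟩) = v := by simp [f]
  have := hmem (e.symm ⟨v, hVW hv⟩) (by rwa [Submodule.mem_comap, hfv])
  rwa [Submodule.mem_comap, hprod, hfv] at this

theorem mixedDiff_const (τ : ℝ → Module.End ℂ X) (m : ℕ) (h : ℝ) :
    mixedDiff τ m (fun _ => h) = iterDiff τ m h := by
  rw [mixedDiff_eq_prod, iterDiff_eq_pow, List.ofFn_const, List.prod_replicate]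

end Abstract

end DeltaInvariant

theorem theorem4p2 (m : ℕ) (hm : 1 ≤ m) :
    (∀ V : Submodule ℂ C(ℝ, ℂ), FiniteDimensional ℂ V →
      ((∀ h : ℝ, V.map (DeltaInvariant.iterDiff DeltaInvariant.translateFun m h) ≤ V) ↔
        (∀ h : Fin m → ℝ,
          V.map (DeltaInvariant.mixedDiff DeltaInvariant.translateFun m h) ≤ V))) ∧
    (∀ V : Submodule ℂ DeltaInvariant.Distr, FiniteDimensional ℂ V →
      ((∀ h : ℝ, V.map (DeltaInvariant.iterDiff DeltaInvariant.translateDistr m h) ≤ V) ↔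
        (∀ h : Fin m → ℝ,
          V.map (DeltaInvariant.mixedDiff DeltaInvariant.translateDistr m h) ≤ V))) := by
  open DeltaInvariant in
  refine ⟨fun V _ => ⟨fun hV => ?_, fun hV h => mixedDiff_const translateFun m h ▸ hV _⟩,
    fun V _ => ⟨fun hV => ?_, fun hV h => mixedDiff_const translateDistr m h ▸ hV _⟩⟩
  · let E : C(ℝ, ℂ) →ₗ[ℂ] ℝ → ℂ :=
      { toFun := fun f t => f t, map_add' := fun _ _ => rfl, map_smul' := fun _ _ => rfl }
    refine map_mixedDiff_le (E := E) translateFun_zero translateFun_add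
      (fun f g hfg => ContinuousMap.ext (congrFun hfg)) (fun f => continuous_pi fun t => ?_) hm hV
    exact f.continuous.comp (continuous_const.add continuous_id)
  · let E : Distr →ₗ[ℂ] Test → ℂ :=
      { toFun := fun T φ => T φ, map_add' := fun _ _ => rfl, map_smul' := fun _ _ => rfl }
    refine map_mixedDiff_le (E := E) translateDistr_zero translateDistr_add
      (fun S T hST => DFunLike.ext _ _ (congrFun hST)) (fun T => continuous_pi fun φ => ?_) hm hV
    exact (map_continuous T).comp ((continuous_translateTest φ).comp continuous_neg)
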